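/- Let $(X,\rho)$ be a non-empty bounded pseudo-metric space. For $\delta>0$ let $N_\delta^\rho(X)\in\mathbb N\cup\{\infty\}$ be the minimal number of closed balls $\{y\in X:\rho(x,y)\le\delta\}$, with centres $x\in X$, needed to cover $X$, and let $$\overline{\dim}_B^{\rho}(X):=\limsup_{\delta\to0^+}\frac{\log N_\delta^\rho(X)}{\log(1/\delta)}\in[0,\infty]$$ be the upper box-counting dimension. For a finite set $W\subseteq X$, a Vietoris–Rips filtration of $W$ is a sequence of simplicial complexes $\emptyset=K^0\subset K^1\subset\dots\subset K^N$, where $K^N$ consists of all non-empty subsets of $W$ and $K^{i}=K^{i-1}\cup\{s_i\}$ for a single new simplex $s_i$; the simplices are added in increasing order of their scale $\delta(s)=\max_{x,y\in s}\rho(x,y)$, those of equal scale in increasing order of dimension, and those of equal scale and dimension in arbitrary order. Let $\mathrm{PH}^0$ be the multiset of pairs $(0,\delta(s_i))$, one for each $i$ such that $K^{i}$ has one connected component less than $K^{i-1}$. For $\alpha>0$ put $E_\alpha(W):=\sum_{(b,d)\in\mathrm{PH}^0}(d-b)^\alpha$, and let $$\dim_{\mathrm{PH}^0}^{\rho}(X):=\inf\{\alpha>0:\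 \exists C>0\ \ \forall W\subseteq X\text{ finite},\ E_\alpha(W)<C\}\in[0,\infty],\qquad \inf\emptyset=\infty,$$ be the persistent homology dimension of degree $0$, where the bound $E_\alpha(W)<C$ is required for every choice of the Vietoris–Rips filtration of $W$. Then $$\overline{\dim}_B^{\rho}(X)=\dim_{\mathrm{PH}^0}^{\rho}(X).$$ -/

import Mathlib

open Filter Topology
open scoped NNReal ENNReal

noncomputable section

namespace PHDim

universe u

/-- The upper box-counting dimension of a (pseudo-)metric space,
`limsup_{δ → 0⁺} log N_δ / log (1/δ)`, where `N_δ` is the minimal number of closed `δ`-balls with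
centres in `X` that cover `X`.  It is an extended real number (equal to `⊤` when `N_δ = ∞` for
small `δ`). -/
def upperBoxDim (X : Type u) [PseudoMetricSpace X] : EReal :=
  limsup (fun δ : ℝ≥0 =>
      ENNReal.log ((Metric.coveringNumber δ (Set.univ : Set X) : ℕ∞) : ℝ≥0∞) /
        ((Real.log (1 / (δ : ℝ)) : ℝ) : EReal))
    (𝓝[>] (0 : ℝ≥0))

section Complexes

variable {X : Type u}

/-- The graph of a simplicial complex: its nodes are the vertices of the complex, and two distinct
vertices are adjacent when they lie in a common simplex (equivalently, span an edge of the
complex). -/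
def skeletonGraph (K : PreAbstractSimplicialComplex X) : SimpleGraph {v : X // {v} ∈ K} where
  Adj v w := v ≠ w ∧ ∃ s ∈ K, v.1 ∈ s ∧ w.1 ∈ s
  symm := ⟨fun _ _ h => ⟨h.1.symm, h.2.imp fun _ hs => ⟨hs.1, hs.2.2, hs.2.1⟩⟩⟩
  loopless := ⟨fun _ h => h.1 rfl⟩

/-- The number of connected components of a (finite) simplicial complex. -/
def numComponents (K : PreAbstractSimplicialComplex X) : ℕ :=
  Nat.card (skeletonGraph K).ConnectedComponent

/-- A filtration of a finite simplicial complex `L`: an increasing sequence of complexes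
`∅ = K⁰ ⊂ K¹ ⊂ ⋯ ⊂ Kᴺ = L`, each obtained from the previous one by adding one simplex. -/
structure SimplexFiltration (L : PreAbstractSimplicialComplex X) where
  /-- the number of simplices -/
  length : ℕ
  /-- the complexes -/
  complex : Fin (length + 1) → PreAbstractSimplicialComplex X
  /-- the simplex that is added at each step -/
  simplex : Fin length → Finset X
  complex_zero : complex 0 = ⊥
  complex_last : complex (Fin.last length) = L
  simplex_notMem : ∀ i, simplex i ∉ complex i.castSucc
  complex_succ : ∀ i, (complex i.succ).faces = insert (simplex i) (complex i.castSucc).faces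

/-- The complex of all non-empty subsets of the finite set `W`. -/
def fullComplex (W : Finset X) : PreAbstractSimplicialComplex X where
  faces := {s | s.Nonempty ∧ s ⊆ W}
  isRelLowerSet_faces := fun _ hs => ⟨hs.1, fun _ hts ht => ⟨ht, hts.trans hs.2⟩⟩

end Complexes

section Rips

variable {X : Type u} [PseudoMetricSpace X]

/-- The Vietoris–Rips complex of a finite set `W` at scale `δ`: its simplices are the non-empty
subsets of `W` whose points are at pairwise distance at most `δ`. -/
def ripsComplex (W : Finset X) (δ : ℝ) : PreAbstractSimplicialComplex X where
  faces := {s | (s.Nonempty ∧ s ⊆ W) ∧ ∀ x ∈ s, ∀ y ∈ s, dist x y ≤ δ}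
  isRelLowerSet_faces := fun _ hs =>
    ⟨hs.1.1, fun _ hts ht =>
      ⟨⟨ht, hts.trans hs.1.2⟩, fun x hx y hy => hs.2 x (hts hx) y (hts hy)⟩⟩

/-- The diameter of a simplex is the scale at which it enters the Vietoris–Rips complex. -/
theorem mem_ripsComplex_iff {W s : Finset X} {δ : ℝ} (hs : s.Nonempty) (hW : s ⊆ W) :
    s ∈ ripsComplex W δ ↔ Metric.diam (s : Set X) ≤ δ := by
  constructor
  · intro h
    obtain ⟨x, hx⟩ := hs
    exact Metric.diam_le_of_forall_dist_le (dist_nonneg.trans (h.2 x hx x hx))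
      (fun a ha b hb => h.2 a ha b hb)
  · intro h
    exact ⟨⟨hs, hW⟩, fun x hx y hy =>
      (Metric.dist_le_diam_of_mem s.finite_toSet.isBounded hx hy).trans h⟩

/-- A Vietoris–Rips filtration of a finite set `W`: the simplices on `W` are added one by one, in
increasing order of the scale at which they enter the Vietoris–Rips complex; simplices that enter
at the same scale are ordered by dimension, and arbitrarily if they also have the same
dimension. -/
structure RipsFiltration (W : Finset X) extends SimplexFiltration (fullComplex W) where
  sorted : Monotone fun i =>
    toLex (Metric.diam (simplex i : Set X), (simplex i).card)

/-- Every finite set has a Vietoris–Rips filtration. -/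
theorem nonempty_ripsFiltration (W : Finset X) : Nonempty (RipsFiltration W) := by
  classical
  let S := {s : Finset X // s ∈ W.powerset.erase ∅}
  let e : S ≃ Fin (Fintype.card S) := Fintype.equivFin S
  let f : Fin (Fintype.card S) → ℝ ×ₗ ℕ := fun i =>
    toLex (Metric.diam ((e.symm i).1 : Set X), (e.symm i).1.card)
  let g : Fin (Fintype.card S) ≃ S := (Tuple.sort f).trans e.symm
  have hg : Monotone fun i => toLex (Metric.diam ((g i).1 : Set X), (g i).1.card) :=
    Tuple.monotone_sort f
  have hmem : ∀ i, ((g i).1).Nonempty ∧ (g i).1 ⊆ W := by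
    intro i
    have := (g i).2
    rw [Finset.mem_erase, Finset.mem_powerset] at this
    exact ⟨Finset.nonempty_iff_ne_empty.2 this.1, this.2⟩
  have hsurj : ∀ s : Finset X, s.Nonempty → s ⊆ W → ∃ j, (g j).1 = s := by
    intro s h1 h2
    refine ⟨g.symm ⟨s, ?_⟩, by simp⟩
    rw [Finset.mem_erase, Finset.mem_powerset]
    exact ⟨h1.ne_empty, h2⟩
  have hinj : ∀ i j, (g i).1 = (g j).1 → i = j := fun i j h => g.injective (Subtype.ext h)
  refine ⟨{
    length := Fintype.card S
    complex := fun i =>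
      { faces := {s | ∃ j, j.castSucc < i ∧ (g j).1 = s}
        isRelLowerSet_faces := ?_ }
    simplex := fun i => (g i).1
    complex_zero := ?_
    complex_last := ?_
    simplex_notMem := ?_
    complex_succ := ?_
    sorted := hg }⟩
  · rintro s ⟨j, hj, rfl⟩
    refine ⟨(hmem j).1, fun t hts ht => ?_⟩
    obtain ⟨k, hk⟩ := hsurj t ht (hts.trans (hmem j).2)
    refine ⟨k, lt_of_le_of_lt (Fin.castSucc_le_castSucc_iff.2 ?_) hj, hk⟩
    by_contra hlt
    have hle := hg (le_of_lt (not_le.1 hlt))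
    have hdiam : Metric.diam (t : Set X) ≤ Metric.diam ((g j).1 : Set X) :=
      Metric.diam_mono (by exact_mod_cast hts) (g j).1.finite_toSet.isBounded
    have hts' : t ⊂ (g j).1 := lt_of_le_of_ne hts (by
      intro h
      exact hlt (hinj k j (hk.trans h)).le)
    have hcard := Finset.card_lt_card hts'
    simp only [hk, Prod.Lex.toLex_le_toLex] at hle
    rcases hle with h | ⟨_, h⟩
    · exact absurd h (not_lt.2 hdiam)
    · omega
  · ext s
    constructor
    · rintro ⟨j, hj, -⟩
      exact absurd hj (Fin.not_lt_zero _)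
    · intro h
      exact h.elim
  · ext s
    constructor
    · rintro ⟨j, -, rfl⟩
      exact hmem j
    · rintro ⟨h1, h2⟩
      obtain ⟨j, hj⟩ := hsurj s h1 h2
      exact ⟨j, Fin.castSucc_lt_last j, hj⟩
  · rintro i ⟨j, hj, h⟩
    rw [hinj j i h] at hj
    exact lt_irrefl _ hj
  · intro i
    ext s
    simp only [Set.mem_insert_iff, Set.mem_ofPred_eq, Fin.castSucc_lt_succ_iff,
      Fin.castSucc_lt_castSucc_iff]
    constructor
    · rintro ⟨j, hj, rfl⟩
      rcases hj.lt_or_eq with h | h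
      · exact Or.inr ⟨j, h, rfl⟩
      · exact Or.inl (by rw [h])
    · rintro (rfl | ⟨j, hj, rfl⟩)
      · exact ⟨i, le_rfl, rfl⟩
      · exact ⟨j, hj.le, rfl⟩

open Classical in
/-- Persistent homology of degree `0` of a Vietoris–Rips filtration: the multiset of the pairs
`(birth, death) = (0, δ)`, one for each step of the filtration at which the number of connected
components drops by one, `δ` being the scale of that step. -/
def persistentHomologyZero {W : Finset X} (F : RipsFiltration W) : Multiset (ℝ × ℝ) :=
  (Finset.univ.filter fun i : Fin F.length =>
      numComponents (F.complex i.succ) + 1 = numComponents (F.complex i.castSucc)).val.map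
    fun i => ((0 : ℝ), Metric.diam (F.simplex i : Set X))

/-- The `α`-weighted sum of lifetimes `∑ (death - birth) ^ α`. -/
def lifetimeSum (α : ℝ) {W : Finset X} (F : RipsFiltration W) : ℝ :=
  ((persistentHomologyZero F).map fun p => (p.2 - p.1) ^ α).sum

end Rips

/-- The persistent homology dimension of degree `0`: the infimum (in the extended reals, with
`inf ∅ = ⊤`) of the `α > 0` for which the `α`-weighted lifetime sums of all finite subsets of `X`
are bounded by one constant.  The bound is required for every Vietoris–Rips filtration of the
finite subset, i.e. for every way of breaking ties; such filtrations always exist. -/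
def phDimZero (X : Type u) [PseudoMetricSpace X] : EReal :=
  sInf {a : EReal | ∃ α : ℝ, a = (α : EReal) ∧ 0 < α ∧
    ∃ C : ℝ, 0 < C ∧ ∀ (W : Finset X) (F : RipsFiltration W), lifetimeSum α F < C}

end PHDim

end

/-!
Adding a simplex to a complex either creates a new component (a vertex), or joins two components,
or leaves their number unchanged; so along a filtration the number of components plus the number of
merges so far is the number of vertices.  Comparing the Rips complex of `W` at scale `δ` with the
full complex, which has at most one component, shows that up to an error of one the number of
intervals of length greater than `δ` is the number of components of the Rips complex at scale `δ`.
That number is `#W` if `W` is `δ`-separated, and it never exceeds the `δ`-packing number, because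
points in different components are more than `δ` apart.  Packing numbers are comparable with
covering numbers, and the layer cake formula `∑ d ^ α = α ∫ t ^ (α - 1) #{d > t} dt` turns a bound
`O(t ^ (-β))`, `β < α`, for the number of intervals longer than `t` into a bound for the lifetime
sum.
-/

namespace PHDim

section ConnectedComponents

open SimpleGraph

variable {V W : Type*}

theorem eq_of_reachable_of_adj {β : Type*} {G : SimpleGraph V} {f : V → β}
    (hf : ∀ v w, G.Adj v w → f v = f w) {v w : V} (h : G.Reachable v w) : f v = f w := by
  obtain ⟨p⟩ := h
  induction p with
  | nil => rfl
  | cons hadj _ ih => exact (hf _ _ hadj).trans ih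

theorem card_connectedComponent_bot : Nat.card (⊥ : SimpleGraph V).ConnectedComponent =
    Nat.card V :=
  (Nat.card_eq_of_bijective (⊥ : SimpleGraph V).connectedComponentMk
    ⟨fun _ _ h => reachable_bot.1 (ConnectedComponent.exact h), Quot.mk_surjective⟩).symm

theorem card_connectedComponent_sum [Finite V] [Finite W] (G : SimpleGraph V)
    (H : SimpleGraph W) : Nat.card (G ⊕g H).ConnectedComponent =
      Nat.card G.ConnectedComponent + Nat.card H.ConnectedComponent := by
  let toSum : V ⊕ W → G.ConnectedComponent ⊕ H.ConnectedComponent :=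
    Sum.map G.connectedComponentMk H.connectedComponentMk
  have htoSum : ∀ v w, (G ⊕g H).Adj v w → toSum v = toSum w := by
    rintro (v | v) (w | w) h
    · exact congrArg Sum.inl (ConnectedComponent.connectedComponentMk_eq_of_adj h)
    · cases h
    · cases h
    · exact congrArg Sum.inr (ConnectedComponent.connectedComponentMk_eq_of_adj h)
  let e : (G ⊕g H).ConnectedComponent ≃ G.ConnectedComponent ⊕ H.ConnectedComponent :=
    { toFun := ConnectedComponent.lift toSum fun _ _ p _ => eq_of_reachable_of_adj htoSum ⟨p⟩
      invFun := Sum.elim (ConnectedComponent.map Embedding.sumInl.toHom)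
        (ConnectedComponent.map Embedding.sumInr.toHom)
      left_inv := by rintro ⟨v | w⟩ <;> rfl
      right_inv := by rintro (C | C) <;> induction C using ConnectedComponent.ind <;> rfl }
  rw [Nat.card_congr e, Nat.card_sum]

theorem card_connectedComponent_le_card_sup_edge_add_one [Finite V] (G : SimpleGraph V)
    (a b : V) : Nat.card G.ConnectedComponent ≤
      Nat.card (G ⊔ edge a b).ConnectedComponent + 1 := by
  classical
  let f : V → G.ConnectedComponent := fun v =>
    if G.connectedComponentMk v = G.connectedComponentMk a then G.connectedComponentMk b
    else G.connectedComponentMk v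
  have hf : ∀ v w, (G ⊔ edge a b).Adj v w → f v = f w := by
    intro v w h
    rcases h with h | h
    · simp only [f, ConnectedComponent.connectedComponentMk_eq_of_adj h]
    · obtain ⟨⟨rfl, rfl⟩ | ⟨rfl, rfl⟩, -⟩ := (edge_adj ..).1 h <;> simp [f]
  let g : Option (G ⊔ edge a b).ConnectedComponent → G.ConnectedComponent := fun o =>
    o.elim (G.connectedComponentMk a)
      (ConnectedComponent.lift f fun _ _ p _ => eq_of_reachable_of_adj hf ⟨p⟩)
  have hg : Function.Surjective g := by
    rintro ⟨v⟩
    by_cases hv : G.connectedComponentMk v = G.connectedComponentMk a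
    · exact ⟨none, hv.symm⟩
    · exact ⟨some ((G ⊔ edge a b).connectedComponentMk v), if_neg hv⟩
  exact (Nat.card_le_card_of_surjective g hg).trans_eq Finite.card_option

end ConnectedComponents

section Complexes

open SimpleGraph

variable {X : Type u} {K K' : PreAbstractSimplicialComplex X} {s : Finset X} {v : X}

theorem skeletonGraph_adj_iff [DecidableEq X] {v w : {v : X // {v} ∈ K}} :
    (skeletonGraph K).Adj v w ↔ v ≠ w ∧ {v.1, w.1} ∈ K := by
  refine and_congr_right fun _ => ⟨?_, fun h => ⟨_, h, by simp⟩⟩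
  rintro ⟨s, hs, hv, hw⟩
  exact (K.isRelLowerSet_faces hs).2
    (Finset.insert_subset hv (Finset.singleton_subset_iff.2 hw)) (Finset.insert_nonempty _ _)

theorem singleton_mem_of_mem (hs : s ∈ K) (hv : v ∈ s) : {v} ∈ K :=
  (K.isRelLowerSet_faces hs).2 (Finset.singleton_subset_iff.2 hv) (Finset.singleton_nonempty v)

theorem card_connectedComponent_comap_skeletonGraph {V : Type*} (e : V ≃ {v : X // {v} ∈ K}) :
    Nat.card ((skeletonGraph K).comap e).ConnectedComponent = numComponents K :=
  Nat.card_congr (Iso.comap e (skeletonGraph K)).connectedComponentEquiv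

theorem mem_iff_of_faces_eq_insert (hK : K'.faces = insert s K.faces) {t : Finset X} :
    t ∈ K' ↔ t = s ∨ t ∈ K :=
  Set.ext_iff.1 hK t

/-- The vertices of the complex `K'` obtained from `K` by adding a new vertex `v`. -/
noncomputable def insertVertexEquiv (hK : K'.faces = insert {v} K.faces) (hv : {v} ∉ K) :
    {w : X // {w} ∈ K} ⊕ Unit ≃ {w : X // {w} ∈ K'} :=
  Equiv.ofBijective
    (Sum.elim (fun w => ⟨w.1, (mem_iff_of_faces_eq_insert hK).2 (Or.inr w.2)⟩)
      fun _ => ⟨v, (mem_iff_of_faces_eq_insert hK).2 (Or.inl rfl)⟩) <| by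
    constructor
    · rintro (w | _) (w' | _) h
      · exact congrArg Sum.inl (Subtype.ext (Subtype.mk.inj h))
      · exact absurd (Subtype.mk.inj h ▸ w.2) hv
      · exact absurd ((Subtype.mk.inj h).symm ▸ w'.2) hv
      · rfl
    · rintro ⟨w, hw⟩
      rcases (mem_iff_of_faces_eq_insert hK).1 hw with h | h
      · exact ⟨Sum.inr (), Subtype.ext (Finset.singleton_injective h).symm⟩
      · exact ⟨Sum.inl ⟨w, h⟩, rfl⟩

theorem card_vertices_of_insert_singleton [Finite {w : X // {w} ∈ K}]
    (hK : K'.faces = insert {v} K.faces) (hv : {v} ∉ K) :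
    Nat.card {w : X // {w} ∈ K'} = Nat.card {w : X // {w} ∈ K} + 1 := by
  rw [← Nat.card_congr (insertVertexEquiv hK hv), Nat.card_sum,
    Nat.card_unique (α := Unit)]

theorem comap_insertVertexEquiv_skeletonGraph (hK : K'.faces = insert {v} K.faces)
    (hv : {v} ∉ K) :
    (skeletonGraph K').comap (insertVertexEquiv hK hv) = skeletonGraph K ⊕g ⊥ := by
  classical
  have h_new : ∀ w : {w : X // {w} ∈ K}, {w.1, v} ∉ K' := by
    intro w hw
    rcases (mem_iff_of_faces_eq_insert hK).1 hw with h | h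
    · have hwv : w.1 = v := Finset.mem_singleton.1 (h ▸ Finset.mem_insert_self w.1 {v})
      exact hv (hwv ▸ w.2)
    · exact hv (singleton_mem_of_mem h (by simp))
  have h_old : ∀ w w' : {w : X // {w} ∈ K}, w ≠ w' → ({w.1, w'.1} ∈ K' ↔ {w.1, w'.1} ∈ K) := by
    intro w w' hww'
    rw [mem_iff_of_faces_eq_insert hK, or_iff_right]
    intro h
    have h_mem : ∀ x ∈ ({w.1, w'.1} : Finset X), x = v := fun x hx =>
      Finset.mem_singleton.1 (h ▸ hx)
    exact hww' (Subtype.ext ((h_mem _ (by simp)).trans (h_mem _ (by simp)).symm))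
  ext x y
  rw [comap_adj, skeletonGraph_adj_iff, (insertVertexEquiv hK hv).injective.ne_iff]
  rcases x with w | _ <;> rcases y with w' | _
  · rw [Sum.inl_injective.ne_iff]
    exact (and_congr_right (h_old w w')).trans skeletonGraph_adj_iff.symm
  · exact iff_of_false (fun h => h_new w h.2) (fun h => by cases h)
  · exact iff_of_false (fun h => h_new w' (Finset.pair_comm v w'.1 ▸ h.2)) (fun h => by cases h)
  · simp

theorem numComponents_of_insert_singleton [Finite {w : X // {w} ∈ K}]
    (hK : K'.faces = insert {v} K.faces) (hv : {v} ∉ K) :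
    numComponents K' = numComponents K + 1 := by
  rw [← card_connectedComponent_comap_skeletonGraph (insertVertexEquiv hK hv),
    comap_insertVertexEquiv_skeletonGraph, card_connectedComponent_sum,
    card_connectedComponent_bot, Nat.card_unique (α := Unit), numComponents]

theorem singleton_mem_iff_of_card_ne_one (hK : K'.faces = insert s K.faces) (hs : s.card ≠ 1) :
    {v} ∈ K' ↔ {v} ∈ K := by
  rw [mem_iff_of_faces_eq_insert hK, or_iff_right]
  rintro rfl
  exact hs (Finset.card_singleton v)

theorem numComponents_of_insert_of_card_ne_one [Finite {w : X // {w} ∈ K}]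
    (hK : K'.faces = insert s K.faces) (hs : s.card ≠ 1) :
    numComponents K' ≤ numComponents K ∧ numComponents K ≤ numComponents K' + 1 := by
  classical
  have hsK' : s ∈ K' := (mem_iff_of_faces_eq_insert hK).2 (Or.inl rfl)
  obtain ⟨a, has, b, hbs, hab⟩ := Finset.one_lt_card.1
    (lt_of_le_of_ne (Finset.card_pos.2 (K'.isRelLowerSet_faces hsK').1) hs.symm)
  have h_vertex : ∀ {x}, x ∈ s → {x} ∈ K := fun hx =>
    (singleton_mem_iff_of_card_ne_one hK hs).1 (singleton_mem_of_mem hsK' hx)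
  let e : {w : X // {w} ∈ K} ≃ {w : X // {w} ∈ K'} :=
    Equiv.subtypeEquivRight fun w => (singleton_mem_iff_of_card_ne_one hK hs).symm
  have h_le : skeletonGraph K ≤ (skeletonGraph K').comap e := fun v w h =>
    ⟨e.injective.ne h.1, h.2.imp fun t ht =>
      ⟨(mem_iff_of_faces_eq_insert hK).2 (Or.inr ht.1), ht.2⟩⟩
  have h_ge : (skeletonGraph K').comap e ≤
      skeletonGraph K ⊔ edge ⟨a, h_vertex has⟩ ⟨b, h_vertex hbs⟩ := by
    intro v w h
    rw [comap_adj, skeletonGraph_adj_iff, e.injective.ne_iff] at h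
    rcases (mem_iff_of_faces_eq_insert hK).1 h.2 with h_eq | h_mem
    · right
      have ha : a = v.1 ∨ a = w.1 := by simpa [← h_eq, e] using has
      have hb : b = v.1 ∨ b = w.1 := by simpa [← h_eq, e] using hbs
      rw [edge_adj]
      grind
    · exact Or.inl (skeletonGraph_adj_iff.2 ⟨h.1, h_mem⟩)
  rw [← card_connectedComponent_comap_skeletonGraph e]
  exact ⟨ConnectedComponent.card_le_card_of_le h_le,
    (card_connectedComponent_le_card_sup_edge_add_one _ _ _).trans
      (Nat.add_le_add_right (ConnectedComponent.card_le_card_of_le h_ge) 1)⟩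

theorem singleton_mem_fullComplex_iff {W : Finset X} : {v} ∈ fullComplex W ↔ v ∈ W :=
  ⟨fun h => Finset.singleton_subset_iff.1 h.2,
    fun h => ⟨Finset.singleton_nonempty v, Finset.singleton_subset_iff.2 h⟩⟩

theorem card_vertices_fullComplex (W : Finset X) :
    Nat.card {v : X // {v} ∈ fullComplex W} = W.card :=
  Nat.subtype_card W fun _ => singleton_mem_fullComplex_iff.symm

theorem numComponents_fullComplex_le_one (W : Finset X) : numComponents (fullComplex W) ≤ 1 := by
  classical
  have h_preconnected : (skeletonGraph (fullComplex W)).Preconnected := by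
    intro v w
    by_cases hvw : v = w
    · exact hvw ▸ Reachable.refl v
    · exact (skeletonGraph_adj_iff.2 ⟨hvw, Finset.insert_nonempty _ _,
        Finset.insert_subset (Finset.singleton_subset_iff.1 v.2.2) w.2.2⟩).reachable
  have := h_preconnected.subsingleton_connectedComponent
  exact Finite.card_le_one_iff_subsingleton.2 this

end Complexes

namespace SimplexFiltration

variable {X : Type u} {L : PreAbstractSimplicialComplex X} (F : SimplexFiltration L)

theorem mem_complex_iff (k : Fin (F.length + 1)) {t : Finset X} :
    t ∈ F.complex k ↔ ∃ i : Fin F.length, i.castSucc < k ∧ F.simplex i = t := by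
  induction k using Fin.induction with
  | zero =>
    simpa [F.complex_zero] using fun h : t ∈ (⊥ : PreAbstractSimplicialComplex X) => h.elim
  | succ j ih =>
    rw [mem_iff_of_faces_eq_insert (F.complex_succ j), ih]
    simp only [Fin.castSucc_lt_succ_iff, Fin.castSucc_lt_castSucc_iff, le_iff_eq_or_lt,
      or_and_right, exists_or, exists_eq_left, eq_comm (a := t)]

instance finite_vertices (k : Fin (F.length + 1)) : Finite {v : X // {v} ∈ F.complex k} := by
  choose i hi using fun v : {v : X // {v} ∈ F.complex k} => (F.mem_complex_iff k).1 v.2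
  refine Finite.of_injective i fun v w h => Subtype.ext (Finset.singleton_injective ?_)
  rw [← (hi v).2, ← (hi w).2, h]

open Classical in
/-- The steps of a filtration at which two connected components are joined. -/
noncomputable def mergeSteps : Finset (Fin F.length) :=
  {i | numComponents (F.complex i.succ) + 1 = numComponents (F.complex i.castSucc)}

theorem mem_mergeSteps_iff {i : Fin F.length} : i ∈ F.mergeSteps ↔
    numComponents (F.complex i.succ) + 1 = numComponents (F.complex i.castSucc) := by
  simp [mergeSteps]

theorem numComponents_succ_add (i : Fin F.length) :
    numComponents (F.complex i.succ) + (if i ∈ F.mergeSteps then 1 else 0) +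
        Nat.card {v : X // {v} ∈ F.complex i.castSucc} =
      numComponents (F.complex i.castSucc) + Nat.card {v : X // {v} ∈ F.complex i.succ} := by
  simp only [mem_mergeSteps_iff]
  by_cases hs : (F.simplex i).card = 1
  · obtain ⟨v, hv⟩ := Finset.card_eq_one.1 hs
    have h_succ := hv ▸ F.complex_succ i
    have h_notMem := hv ▸ F.simplex_notMem i
    have h_comp := numComponents_of_insert_singleton h_succ h_notMem
    have h_vert := card_vertices_of_insert_singleton h_succ h_notMem
    split_ifs <;> omega
  · have h_comp := numComponents_of_insert_of_card_ne_one (F.complex_succ i) hs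
    have h_vert : Nat.card {v : X // {v} ∈ F.complex i.succ} =
        Nat.card {v : X // {v} ∈ F.complex i.castSucc} :=
      Nat.card_congr <| Equiv.subtypeEquivRight fun _ =>
        singleton_mem_iff_of_card_ne_one (F.complex_succ i) hs
    split_ifs <;> omega

theorem card_mergeSteps_lt_succ (i : Fin F.length) :
    (F.mergeSteps.filter fun j => j.castSucc < i.succ).card =
      (F.mergeSteps.filter fun j => j.castSucc < i.castSucc).card +
        if i ∈ F.mergeSteps then 1 else 0 := by
  simp only [Fin.castSucc_lt_succ_iff, Fin.castSucc_lt_castSucc_iff, le_iff_eq_or_lt,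
    Finset.filter_or]
  rw [Finset.card_union_of_disjoint, add_comm, Finset.filter_eq']
  · split_ifs <;> simp
  · exact Finset.disjoint_filter.2 fun j _ h => h ▸ lt_irrefl j

theorem numComponents_add_card_mergeSteps (k : Fin (F.length + 1)) :
    numComponents (F.complex k) + (F.mergeSteps.filter fun i => i.castSucc < k).card =
      Nat.card {v : X // {v} ∈ F.complex k} := by
  induction k using Fin.induction with
  | zero =>
    have : IsEmpty {v : X // {v} ∈ F.complex 0} :=
      ⟨fun v => by simpa using (F.mem_complex_iff 0).1 v.2⟩
    simp [numComponents]
  | succ i ih =>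
    rw [F.card_mergeSteps_lt_succ]
    linarith [F.numComponents_succ_add i]

end SimplexFiltration

section Rips

variable {X : Type u} [PseudoMetricSpace X] {W : Finset X}

theorem card_vertices_ripsComplex {δ : ℝ} (hδ : 0 ≤ δ) :
    Nat.card {v : X // {v} ∈ ripsComplex W δ} = W.card :=
  Nat.subtype_card W fun v => singleton_mem_fullComplex_iff.symm.trans
    ⟨fun h => (mem_ripsComplex_iff h.1 h.2).2 (by simpa using hδ), fun h => h.1⟩

theorem skeletonGraph_ripsComplex_adj_iff {δ : ℝ} {v w : {v : X // {v} ∈ ripsComplex W δ}} :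
    (skeletonGraph (ripsComplex W δ)).Adj v w ↔ v ≠ w ∧ dist v.1 w.1 ≤ δ := by
  classical
  rw [skeletonGraph_adj_iff]
  refine and_congr_right fun _ => ⟨fun h => h.2 _ (by simp) _ (by simp), fun h => ?_⟩
  have h_subset : {v.1, w.1} ⊆ W :=
    Finset.insert_subset (Finset.singleton_subset_iff.1 v.2.1.2) w.2.1.2
  rw [mem_ripsComplex_iff (Finset.insert_nonempty _ _) h_subset]
  simpa [Metric.diam_pair] using h

theorem numComponents_ripsComplex_le_packingNumber (W : Finset X) (δ : ℝ≥0) :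
    (numComponents (ripsComplex W δ) : ℕ∞) ≤ Metric.packingNumber δ (Set.univ : Set X) := by
  let representative : (skeletonGraph (ripsComplex W δ)).ConnectedComponent → X :=
    fun C => C.out.1
  have h_eq : ∀ C D, dist (representative C) (representative D) ≤ δ → C = D := by
    intro C D h_le
    rw [← C.out_eq, ← D.out_eq]
    by_cases h_out : C.out = D.out
    · rw [h_out]
    · exact SimpleGraph.ConnectedComponent.connectedComponentMk_eq_of_adj
        (skeletonGraph_ripsComplex_adj_iff.2 ⟨h_out, h_le⟩)
  have h_inj : Function.Injective representative := fun C D h =>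
    h_eq C D (by rw [h, dist_self]; exact δ.coe_nonneg)
  have h_separated : Metric.IsSeparated (δ : ℝ≥0∞) (Set.range representative) := by
    rintro _ ⟨C, rfl⟩ _ ⟨D, rfl⟩ hCD
    rw [edist_nndist, ENNReal.coe_lt_coe]
    exact lt_of_not_ge fun h_le => hCD (congrArg representative (h_eq C D h_le))
  rw [numComponents, ← Set.ncard_range_of_injective h_inj]
  exact (Set.ncard_le_encard _).trans
    (h_separated.encard_le_packingNumber (Set.subset_univ _))

theorem numComponents_ripsComplex_of_isSeparated {δ : ℝ≥0}
    (hW : Metric.IsSeparated (δ : ℝ≥0∞) (W : Set X)) :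
    numComponents (ripsComplex W δ) = W.card := by
  have h_bot : skeletonGraph (ripsComplex W δ) = ⊥ := by
    ext v w
    rw [skeletonGraph_ripsComplex_adj_iff]
    refine iff_of_false (fun ⟨hvw, h_le⟩ => ?_) id
    have h_lt : (δ : ℝ≥0∞) < edist v.1 w.1 :=
      hW (v.2.1.2 (Finset.mem_singleton_self _)) (w.2.1.2 (Finset.mem_singleton_self _))
        (Subtype.coe_ne_coe.2 hvw)
    rw [edist_nndist, ENNReal.coe_lt_coe] at h_lt
    exact h_lt.not_ge h_le
  rw [numComponents, h_bot, card_connectedComponent_bot, card_vertices_ripsComplex δ.coe_nonneg]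

theorem lifetimeSum_eq (α : ℝ) (F : RipsFiltration W) :
    lifetimeSum α F = ∑ i ∈ F.mergeSteps, Metric.diam (F.simplex i : Set X) ^ α := by
  simp [lifetimeSum, persistentHomologyZero, SimplexFiltration.mergeSteps, Finset.sum]

namespace RipsFiltration

variable (F : RipsFiltration W)

theorem diam_simplex_mono : Monotone fun i => Metric.diam (F.simplex i : Set X) := fun _ _ h =>
  (Prod.Lex.toLex_le_toLex.1 (F.sorted h)).elim le_of_lt fun h => h.1.le

theorem exists_castSucc_lt_iff_diam_le (δ : ℝ) : ∃ k : Fin (F.length + 1),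
    ∀ i : Fin F.length, i.castSucc < k ↔ Metric.diam (F.simplex i : Set X) ≤ δ := by
  have h_lower : IsLowerSet {i | Metric.diam (F.simplex i : Set X) ≤ δ} := fun i j hji hi =>
    (F.diam_simplex_mono hji).trans hi
  rcases h_lower.eq_univ_or_Iio with h | ⟨j, h⟩
  · exact ⟨Fin.last _, fun i => iff_of_true (Fin.castSucc_lt_last i) (Set.eq_univ_iff_forall.1 h i)⟩
  · exact ⟨j.castSucc, fun i => Fin.castSucc_lt_castSucc_iff.trans (Set.ext_iff.1 h i).symm⟩

theorem simplex_mem_fullComplex (i : Fin F.length) : F.simplex i ∈ fullComplex W := by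
  have := (F.mem_complex_iff (Fin.last _)).2 ⟨i, Fin.castSucc_lt_last i, rfl⟩
  rwa [F.complex_last] at this

theorem complex_eq_ripsComplex {δ : ℝ} {k : Fin (F.length + 1)}
    (hk : ∀ i : Fin F.length, i.castSucc < k ↔ Metric.diam (F.simplex i : Set X) ≤ δ) :
    F.complex k = ripsComplex W δ := by
  refine SetLike.ext fun t => ?_
  rw [F.mem_complex_iff]
  constructor
  · rintro ⟨i, hi, rfl⟩
    obtain ⟨h_nonempty, h_subset⟩ := F.simplex_mem_fullComplex i
    exact (mem_ripsComplex_iff h_nonempty h_subset).2 ((hk i).1 hi)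
  · intro ht
    have h_last : t ∈ F.complex (Fin.last _) := F.complex_last.symm ▸ ht.1
    obtain ⟨i, -, rfl⟩ := (F.mem_complex_iff _).1 h_last
    exact ⟨i, (hk i).2 ((mem_ripsComplex_iff ht.1.1 ht.1.2).1 ht), rfl⟩

theorem card_filter_lt_diam_add_numComponents {δ : ℝ} (hδ : 0 ≤ δ) :
    (F.mergeSteps.filter fun i => δ < Metric.diam (F.simplex i : Set X)).card +
        numComponents (fullComplex W) = numComponents (ripsComplex W δ) := by
  obtain ⟨k, hk⟩ := F.exists_castSucc_lt_iff_diam_le δ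
  have h_rips := F.numComponents_add_card_mergeSteps k
  have h_full := F.numComponents_add_card_mergeSteps (Fin.last _)
  rw [F.complex_eq_ripsComplex hk, card_vertices_ripsComplex hδ] at h_rips
  rw [F.complex_last, card_vertices_fullComplex] at h_full
  simp only [hk] at h_rips
  simp only [Fin.castSucc_lt_last, Finset.filter_true] at h_full
  have h_split := F.mergeSteps.card_filter_add_card_filter_not
    fun i => Metric.diam (F.simplex i : Set X) ≤ δ
  simp only [not_le] at h_split
  omega

theorem card_filter_lt_diam_le_packingNumber (δ : ℝ≥0) :
    ((F.mergeSteps.filter fun i => δ < Metric.diam (F.simplex i : Set X)).card : ℕ∞) ≤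
      Metric.packingNumber δ (Set.univ : Set X) :=
  (Nat.cast_le.2 (Nat.le.intro (F.card_filter_lt_diam_add_numComponents δ.coe_nonneg))).trans
    (numComponents_ripsComplex_le_packingNumber W δ)

theorem card_sub_one_mul_rpow_le_lifetimeSum {α : ℝ} (hα : 0 ≤ α) {δ : ℝ≥0}
    (hW : Metric.IsSeparated (δ : ℝ≥0∞) (W : Set X)) :
    ((W.card : ℝ) - 1) * (δ : ℝ) ^ α ≤ lifetimeSum α F := by
  set long := F.mergeSteps.filter fun i => δ < Metric.diam (F.simplex i : Set X)
  have h_card : W.card ≤ long.card + 1 := by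
    have h := F.card_filter_lt_diam_add_numComponents δ.coe_nonneg
    rw [numComponents_ripsComplex_of_isSeparated hW] at h
    exact h.symm.le.trans (Nat.add_le_add_left (numComponents_fullComplex_le_one W) _)
  calc ((W.card : ℝ) - 1) * (δ : ℝ) ^ α
      ≤ long.card * (δ : ℝ) ^ α := by
        gcongr
        rw [sub_le_iff_le_add]
        exact_mod_cast h_card
    _ = ∑ _i ∈ long, (δ : ℝ) ^ α := by rw [Finset.sum_const, nsmul_eq_mul]
    _ ≤ ∑ i ∈ long, Metric.diam (F.simplex i : Set X) ^ α := by
        gcongr with i hi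
        exact (Finset.mem_filter.1 hi).2.le
    _ ≤ ∑ i ∈ F.mergeSteps, Metric.diam (F.simplex i : Set X) ^ α :=
        Finset.sum_le_sum_of_subset_of_nonneg (Finset.filter_subset _ _)
          fun _ _ _ => Real.rpow_nonneg Metric.diam_nonneg α
    _ = lifetimeSum α F := (lifetimeSum_eq α F).symm

end RipsFiltration

end Rips

section LayerCake

open MeasureTheory Set

theorem lintegral_Ioo_rpow_sub_one {γ D : ℝ} (hγ : 0 < γ) (hD : 0 < D) :
    ∫⁻ t in Ioo 0 D, ENNReal.ofReal (t ^ (γ - 1)) = ENNReal.ofReal (D ^ γ / γ) := by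
  have h_int : IntegrableOn (fun t : ℝ => t ^ (γ - 1)) (Ioo 0 D) :=
    (intervalIntegral.integrableOn_Ioo_rpow_iff hD).2 (by linarith)
  have h_nonneg : 0 ≤ᵐ[volume.restrict (Ioo 0 D)] fun t : ℝ => t ^ (γ - 1) :=
    ae_restrict_of_forall_mem measurableSet_Ioo fun t ht => Real.rpow_nonneg ht.1.le _
  rw [← ofReal_integral_eq_lintegral_ofReal h_int h_nonneg, ← integral_Ioc_eq_integral_Ioo,
    ← intervalIntegral.integral_of_le hD.le, integral_rpow (Or.inl (by linarith)),
    sub_add_cancel, Real.zero_rpow hγ.ne', sub_zero]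

variable {ι : Type*} (s : Finset ι) {d : ι → ℝ} {α : ℝ}

theorem sum_rpow_eq_lintegral_card_lt (hα : 0 < α) (hd : ∀ i ∈ s, 0 ≤ d i) :
    ENNReal.ofReal (∑ i ∈ s, d i ^ α) = ENNReal.ofReal α *
      ∫⁻ t in Ioi 0, (s.filter fun i => t < d i).card * ENNReal.ofReal (t ^ (α - 1)) := by
  classical
  let _ : MeasurableSpace ι := ⊤
  have h_cake := lintegral_rpow_eq_lintegral_meas_lt_mul (Measure.count.restrict (s : Set ι))
    (ae_restrict_of_forall_mem .of_discrete hd) (measurable_from_top (f := d)).aemeasurable hα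
  rw [lintegral_finset] at h_cake
  simp only [Measure.count_singleton, mul_one] at h_cake
  rw [ENNReal.ofReal_sum_of_nonneg fun i hi => Real.rpow_nonneg (hd i hi) α, h_cake]
  congr! 4 with t
  have h_measurable : MeasurableSet {i | t < d i} := .of_discrete
  rw [Measure.restrict_apply h_measurable, ← Measure.count_apply_finset]
  congr 1
  ext
  simp [and_comm]

theorem sum_rpow_le_of_card_lt_le {β A D : ℝ} (hα : 0 < α) (hβα : β < α) (hD : 0 < D)
    (hd : ∀ i ∈ s, 0 ≤ d i) (hdD : ∀ i ∈ s, d i ≤ D)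
    (h : ∀ t, 0 < t → t < D → ((s.filter fun i => t < d i).card : ℝ) ≤ A * t ^ (-β)) :
    ∑ i ∈ s, d i ^ α ≤ α * A * (D ^ (α - β) / (α - β)) := by
  have hA : 0 ≤ A := nonneg_of_mul_nonneg_left
    ((Nat.cast_nonneg _).trans (h (D / 2) (by positivity) (by linarith))) (by positivity)
  have hαβ : 0 < α - β := sub_pos.2 hβα
  have h_bound : ∀ t ∈ Ioi (0 : ℝ),
      (s.filter fun i => t < d i).card * ENNReal.ofReal (t ^ (α - 1)) ≤
        (Iio D).indicator (fun t => ENNReal.ofReal (A * t ^ (α - β - 1))) t := by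
    intro t (ht : 0 < t)
    by_cases htD : t < D
    · rw [indicator_of_mem (mem_Iio.2 htD), ← ENNReal.ofReal_natCast,
        ← ENNReal.ofReal_mul (Nat.cast_nonneg _)]
      refine ENNReal.ofReal_le_ofReal ?_
      calc ((s.filter fun i => t < d i).card : ℝ) * t ^ (α - 1)
          ≤ A * t ^ (-β) * t ^ (α - 1) := by gcongr; exact h t ht htD
        _ = A * t ^ (α - β - 1) := by
          rw [mul_assoc, ← Real.rpow_add ht]
          ring_nf
    · rw [Finset.filter_false_of_mem fun i hi => ((hdD i hi).trans (not_lt.1 htD)).not_gt]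
      simp
  rw [← ENNReal.ofReal_le_ofReal_iff (by positivity)]
  calc ENNReal.ofReal (∑ i ∈ s, d i ^ α)
      = ENNReal.ofReal α *
          ∫⁻ t in Ioi 0, (s.filter fun i => t < d i).card * ENNReal.ofReal (t ^ (α - 1)) :=
        sum_rpow_eq_lintegral_card_lt s hα hd
    _ ≤ ENNReal.ofReal α *
          ∫⁻ t in Ioi 0, (Iio D).indicator (fun t => ENNReal.ofReal (A * t ^ (α - β - 1))) t := by
        gcongr ENNReal.ofReal α * ?_
        exact setLIntegral_mono' measurableSet_Ioi h_bound
    _ = ENNReal.ofReal α *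
          (ENNReal.ofReal A * ∫⁻ t in Ioo 0 D, ENNReal.ofReal (t ^ (α - β - 1))) := by
        rw [setLIntegral_indicator measurableSet_Iio, inter_comm, Ioi_inter_Iio]
        simp only [ENNReal.ofReal_mul hA]
        rw [lintegral_const_mul' _ _ ENNReal.ofReal_ne_top]
    _ = ENNReal.ofReal (α * A * (D ^ (α - β) / (α - β))) := by
        rw [lintegral_Ioo_rpow_sub_one hαβ hD, mul_assoc, ENNReal.ofReal_mul hα.le,
          ENNReal.ofReal_mul hA]

end LayerCake

section CoveringNumbers

open Metric

variable {X : Type u} [PseudoMetricSpace X]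

theorem isBounded_of_coveringNumber_ne_top {δ : ℝ≥0} {s : Set X} (h : coveringNumber δ s ≠ ⊤) :
    Bornology.IsBounded s := by
  refine Bornology.IsBounded.subset ?_ (isCover_minimalCover h).subset_iUnion_closedBall
  exact (Bornology.isBounded_biUnion finite_minimalCover).2 fun _ _ => isBounded_closedBall

theorem packingNumber_le_coveringNumber_of_two_mul_le {δ ε : ℝ≥0} (h : 2 * δ ≤ ε) (s : Set X) :
    packingNumber ε s ≤ coveringNumber δ s := by
  have hδ : δ ≤ ε / 2 := by
    rw [le_div_iff₀ two_pos, mul_comm]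
    exact h
  calc packingNumber ε s = packingNumber (2 * (ε / 2)) s := by
        rw [mul_div_cancel₀ ε two_ne_zero]
    _ ≤ externalCoveringNumber (ε / 2) s := packingNumber_two_mul_le_externalCoveringNumber _ _
    _ ≤ coveringNumber (ε / 2) s := externalCoveringNumber_le_coveringNumber _ _
    _ ≤ coveringNumber δ s := coveringNumber_anti hδ

theorem exists_packingNumber_le_rpow {β : ℝ} {s : Set X}
    (h : ∀ᶠ δ : ℝ≥0 in 𝓝[>] 0,
      (coveringNumber δ s : ℝ≥0∞) ≤ ENNReal.ofReal ((δ : ℝ) ^ (-β))) (D : ℝ≥0) :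
    ∃ A : ℝ, 0 ≤ A ∧ ∀ ε : ℝ≥0, 0 < ε → ε ≤ D →
      (packingNumber ε s : ℝ≥0∞) ≤ ENNReal.ofReal (A * (ε : ℝ) ^ (-β)) := by
  obtain ⟨δ₀, hδ₀ : 0 < δ₀, h_small⟩ := mem_nhdsGT_iff_exists_Ioc_subset.1 h
  set q : ℝ≥0 := max 2 (D / δ₀)
  have hq : 0 < q := two_pos.trans_le (le_max_left _ _)
  refine ⟨(q : ℝ) ^ β, by positivity, fun ε hε hεD => ?_⟩
  have h_le : ε / q ≤ δ₀ := by
    rw [div_le_iff₀ hq, ← div_le_iff₀' hδ₀]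
    exact (div_le_div_of_nonneg_right hεD hδ₀.le).trans (le_max_right _ _)
  have h_two : 2 * (ε / q) ≤ ε := by
    rw [← mul_div_assoc, div_le_iff₀ hq, mul_comm]
    exact mul_le_mul_right (le_max_left _ _) ε
  calc (packingNumber ε s : ℝ≥0∞) ≤ coveringNumber (ε / q) s :=
        ENat.toENNReal_le.2 (packingNumber_le_coveringNumber_of_two_mul_le h_two s)
    _ ≤ ENNReal.ofReal (((ε / q : ℝ≥0) : ℝ) ^ (-β)) := h_small ⟨div_pos hε hq, h_le⟩
    _ = ENNReal.ofReal ((q : ℝ) ^ β * (ε : ℝ) ^ (-β)) := by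
        rw [NNReal.coe_div, Real.div_rpow ε.coe_nonneg q.coe_nonneg,
          Real.rpow_neg q.coe_nonneg, div_inv_eq_mul, mul_comm]

theorem packingNumber_le_of_card_le {δ : ℝ≥0} {s : Set X} {n : ℕ}
    (h : ∀ W : Finset X, (W : Set X) ⊆ s → IsSeparated (δ : ℝ≥0∞) (W : Set X) → W.card ≤ n) :
    packingNumber δ s ≤ n := by
  refine iSup_le fun S => iSup_le fun hSs => iSup_le fun hS => ?_
  by_contra! h_lt
  obtain ⟨T, hTS, hT⟩ := Set.exists_subset_encard_eq (Order.add_one_le_of_lt h_lt)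
  have hT_finite : T.Finite := Set.finite_of_encard_eq_coe (k := n + 1) (by simpa using hT)
  lift T to Finset X using hT_finite
  rw [Set.encard_coe_eq_coe_finsetCard] at hT
  have h_card : T.card = n + 1 := by exact_mod_cast hT
  exact absurd (h T (hTS.trans hSs) (hS.subset hTS)) (by omega)

end CoveringNumbers

section UpperBoxDim

variable {X : Type u} [PseudoMetricSpace X]

theorem tendsto_log_one_div_nhdsGT_zero :
    Tendsto (fun δ : ℝ≥0 => Real.log (1 / (δ : ℝ))) (𝓝[>] 0) atTop := by
  have h_coe : Tendsto (fun δ : ℝ≥0 => (δ : ℝ)) (𝓝[>] 0) (𝓝[>] 0) :=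
    tendsto_nhdsWithin_iff.2 ⟨(NNReal.continuous_coe.tendsto' 0 0 rfl).mono_left
      nhdsWithin_le_nhds, eventually_mem_nhdsWithin⟩
  simpa [Function.comp_def] using
    (Real.tendsto_log_atTop.comp tendsto_inv_nhdsGT_zero).comp h_coe

theorem upperBoxDim_nonneg [Nonempty X] : 0 ≤ upperBoxDim X := by
  refine le_limsup_of_frequently_le (Eventually.frequently ?_)
  filter_upwards [tendsto_log_one_div_nhdsGT_zero.eventually_ge_atTop 0] with δ h_log
  have h_one : 1 ≤ Metric.coveringNumber δ (Set.univ : Set X) :=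
    Order.one_le_iff_pos.2 (Metric.coveringNumber_pos_iff.2 Set.univ_nonempty)
  refine EReal.div_nonneg (ENNReal.zero_le_log_iff.2 ?_) (EReal.coe_nonneg.2 h_log)
  exact_mod_cast ENat.toENNReal_le.2 h_one

theorem upperBoxDim_le_of_eventually_coveringNumber_le {α C : ℝ} (hC : 0 < C)
    (h : ∀ᶠ δ : ℝ≥0 in 𝓝[>] 0, (Metric.coveringNumber δ (Set.univ : Set X) : ℝ≥0∞) ≤
      ENNReal.ofReal (C * (δ : ℝ) ^ (-α))) :
    upperBoxDim X ≤ α := by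
  have h_lim : Tendsto (fun δ : ℝ≥0 =>
      ((Real.log C / Real.log (1 / (δ : ℝ)) + α : ℝ) : EReal)) (𝓝[>] 0) (𝓝 (α : EReal)) := by
    refine (continuous_coe_real_ereal.tendsto α).comp ?_
    simpa using (tendsto_log_one_div_nhdsGT_zero.const_div_atTop (Real.log C)).add_const α
  rw [← h_lim.limsup_eq]
  refine limsup_le_limsup ?_
  filter_upwards [h, tendsto_log_one_div_nhdsGT_zero.eventually_gt_atTop 0,
    self_mem_nhdsWithin] with δ h_cover h_log (hδ : 0 < δ)
  have hδ' : 0 < (δ : ℝ) := hδ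
  rw [EReal.div_le_iff_le_mul (by exact_mod_cast h_log) (EReal.coe_ne_top _)]
  refine (ENNReal.log_monotone h_cover).trans_eq ?_
  rw [ENNReal.log_ofReal_of_pos (by positivity), ← EReal.coe_mul, EReal.coe_eq_coe_iff,
    Real.log_mul hC.ne' (by positivity), Real.log_rpow hδ', mul_add,
    mul_div_cancel₀ _ h_log.ne', one_div, Real.log_inv]
  ring

theorem eventually_coveringNumber_le_of_upperBoxDim_lt {β : ℝ} (h : upperBoxDim X < β) :
    ∀ᶠ δ : ℝ≥0 in 𝓝[>] 0, (Metric.coveringNumber δ (Set.univ : Set X) : ℝ≥0∞) ≤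
      ENNReal.ofReal ((δ : ℝ) ^ (-β)) := by
  filter_upwards [eventually_lt_of_limsup_lt h,
    tendsto_log_one_div_nhdsGT_zero.eventually_gt_atTop 0, self_mem_nhdsWithin]
    with δ h_lt h_log (hδ : 0 < δ)
  have hδ' : 0 < (δ : ℝ) := hδ
  rw [EReal.div_lt_iff (by exact_mod_cast h_log) (EReal.coe_ne_top _)] at h_lt
  rw [← ENNReal.log_le_log_iff, ENNReal.log_ofReal_of_pos (by positivity), Real.log_rpow hδ',
    neg_mul_comm, ← Real.log_inv, ← one_div, EReal.coe_mul]
  exact h_lt.le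

end UpperBoxDim

section Comparison

open Metric

variable {X : Type u} [PseudoMetricSpace X]

theorem coveringNumber_le_of_lifetimeSum_lt {α C : ℝ} (hα : 0 ≤ α)
    (h : ∀ (W : Finset X) (F : RipsFiltration W), lifetimeSum α F < C) {δ : ℝ≥0} (hδ : 0 < δ) :
    (coveringNumber δ (Set.univ : Set X) : ℝ≥0∞) ≤
      ENNReal.ofReal (C * (δ : ℝ) ^ (-α) + 1) := by
  have hδ' : 0 < (δ : ℝ) := hδ
  have h_card : ∀ W : Finset X, IsSeparated (δ : ℝ≥0∞) (W : Set X) →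
      (W.card : ℝ) ≤ C * (δ : ℝ) ^ (-α) + 1 := by
    intro W hW
    obtain ⟨F⟩ := nonempty_ripsFiltration W
    have h_sum : ((W.card : ℝ) - 1) * (δ : ℝ) ^ α ≤ C :=
      (F.card_sub_one_mul_rpow_le_lifetimeSum hα hW).trans (h W F).le
    rwa [← sub_le_iff_le_add, Real.rpow_neg hδ'.le, ← div_eq_mul_inv,
      le_div_iff₀ (by positivity)]
  have h_nonneg : 0 ≤ C * (δ : ℝ) ^ (-α) + 1 := by simpa using h_card ∅ (by simp)
  have h_floor : coveringNumber δ (Set.univ : Set X) ≤ ⌊C * (δ : ℝ) ^ (-α) + 1⌋₊ :=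
    (coveringNumber_le_packingNumber δ _).trans <|
      packingNumber_le_of_card_le fun W _ hW => Nat.le_floor (h_card W hW)
  calc (coveringNumber δ (Set.univ : Set X) : ℝ≥0∞)
      ≤ (⌊C * (δ : ℝ) ^ (-α) + 1⌋₊ : ℕ) := by exact_mod_cast ENat.toENNReal_le.2 h_floor
    _ ≤ ENNReal.ofReal (C * (δ : ℝ) ^ (-α) + 1) := by
        rw [← ENNReal.ofReal_natCast]
        exact ENNReal.ofReal_le_ofReal (Nat.floor_le h_nonneg)

theorem upperBoxDim_le_of_lifetimeSum_lt {α C : ℝ} (hα : 0 ≤ α) (hC : 0 < C)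
    (h : ∀ (W : Finset X) (F : RipsFiltration W), lifetimeSum α F < C) : upperBoxDim X ≤ α := by
  refine upperBoxDim_le_of_eventually_coveringNumber_le (add_pos hC one_pos) ?_
  filter_upwards [self_mem_nhdsWithin, nhdsWithin_le_nhds (Iic_mem_nhds one_pos)]
    with δ (hδ : 0 < δ) (hδ_one : δ ≤ 1)
  refine (coveringNumber_le_of_lifetimeSum_lt hα h hδ).trans (ENNReal.ofReal_le_ofReal ?_)
  have h_one : 1 ≤ (δ : ℝ) ^ (-α) :=
    Real.one_le_rpow_of_pos_of_le_one_of_nonpos hδ hδ_one (neg_nonpos.2 hα)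
  linarith

theorem exists_lifetimeSum_lt_of_upperBoxDim_lt {α β : ℝ} (hα : 0 < α) (hβα : β < α)
    (h : upperBoxDim X < β) :
    ∃ C : ℝ, 0 < C ∧ ∀ (W : Finset X) (F : RipsFiltration W), lifetimeSum α F < C := by
  have h_cover := eventually_coveringNumber_le_of_upperBoxDim_lt h
  obtain ⟨δ, hδ⟩ := h_cover.exists
  have h_bounded : Bornology.IsBounded (Set.univ : Set X) := isBounded_of_coveringNumber_ne_top
    (ENat.toENNReal_ne_top.1 (ne_top_of_le_ne_top ENNReal.ofReal_ne_top hδ))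
  let D : ℝ≥0 := ⟨diam (Set.univ : Set X) + 1, add_nonneg diam_nonneg zero_le_one⟩
  have hD : 0 < (D : ℝ) := add_pos_of_nonneg_of_pos diam_nonneg one_pos
  obtain ⟨A, hA, h_packing⟩ := exists_packingNumber_le_rpow h_cover D
  have h_nonneg : 0 ≤ α * A * ((D : ℝ) ^ (α - β) / (α - β)) :=
    mul_nonneg (by positivity) (div_nonneg (by positivity) (sub_pos.2 hβα).le)
  refine ⟨α * A * ((D : ℝ) ^ (α - β) / (α - β)) + 1, add_pos_of_nonneg_of_pos h_nonneg one_pos,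
    fun W F => lt_add_of_le_of_pos ?_ one_pos⟩
  rw [lifetimeSum_eq]
  refine sum_rpow_le_of_card_lt_le _ hα hβα hD (fun i _ => diam_nonneg) (fun i _ => ?_)
    fun t ht htD => ?_
  · exact (diam_mono (Set.subset_univ _) h_bounded).trans (le_add_of_nonneg_right zero_le_one)
  · lift t to ℝ≥0 using ht.le
    have h_card := (ENat.toENNReal_le.2 (F.card_filter_lt_diam_le_packingNumber t)).trans
      (h_packing t ht htD.le)
    rwa [ENat.toENNReal_coe, ← ENNReal.ofReal_natCast,
      ENNReal.ofReal_le_ofReal_iff (by positivity)] at h_card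

end Comparison

end PHDim

theorem theorem4p1_general {X : Type*} [PseudoMetricSpace X] [Nonempty X] :
    PHDim.upperBoxDim X = PHDim.phDimZero X := by
  refine le_antisymm (le_sInf ?_) (le_of_forall_gt fun c hc => ?_)
  · rintro _ ⟨α, rfl, hα, C, hC, h⟩
    exact PHDim.upperBoxDim_le_of_lifetimeSum_lt hα.le hC h
  · obtain ⟨α, h_lt_α, hαc⟩ := EReal.lt_iff_exists_real_btwn.1 hc
    obtain ⟨β, h_lt_β, hβα⟩ := EReal.lt_iff_exists_real_btwn.1 h_lt_α
    have hα : 0 < α := EReal.coe_pos.1 (PHDim.upperBoxDim_nonneg.trans_lt h_lt_α)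
    refine (sInf_le ?_).trans_lt hαc
    exact ⟨α, rfl, hα, PHDim.exists_lifetimeSum_lt_of_upperBoxDim_lt hα
      (EReal.coe_lt_coe_iff.1 hβα) h_lt_β⟩

theorem theorem4p1 {X : Type*} [PseudoMetricSpace X] [BoundedSpace X] [Nonempty X] :
    PHDim.upperBoxDim X = PHDim.phDimZero X :=
  theorem4p1_general
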